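/- All spaces are complex. Let $p,q\in L_1[0,1]$. Let $W^2_{1,A,U}=\{y\in W_1^2[0,1]: y(1)-y(0)=y'(1)-y'(0)=0\}$, whose elements are written as vector functions $Y=(Y_0,Y_1,Y_2)=(y,y',y'')$, and $C^1_{B,V}=\{z\in C^1[0,1]: z(1)-z(0)=0\}$, whose elements are written as $Z=(Z_0,Z_1)=(z,z')$, with their usual norms. Let $W^{-1}_{1,B,V}$ be the space of those bounded conjugate-linear functionals on $C^1_{B,V}$ which have the form $Z\mapsto\int_0^1 (f_0\overline{Z_0}+f_1\overline{Z_1})\,dx$ with $f_0,f_1\in L_1[0,1]$. Let $T\colon W^2_{1,A,U}\to W^{-1}_{1,B,V}$ be the bounded operator $$\langle TY,Z\rangle=\int_0^1\bigl[(iY_2+pY_1-qY_0)\,\overline{Z_1}-qY_1\,\overline{Z_0}\bigr]\,dx ,$$ let $I\colon W^2_{1,A,U}\to L_2[0,1]$, $IY=Y_0$, and $J\colon L_2[0,1]\to W^{-1}_{1,B,V}$, $\langle Jf,Z\rangle=\int_0^1 f\,\overline{Z_0}\,dx$, be the natural embeddings, and let $T^\bullet=J^{-1}TI^{-1}$ be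 the linear relation in $L_2[0,1]$ with graph $\{(y,f): \exists\, Y\in W^2_{1,A,U},\ IY=y,\ TY=Jf\}$. Then: (1) For all $y,f\in L_2[0,1]$, the pair $(y,f)$ belongs to $T^\bullet$ if and only if $y$ solves the problem of periodic type for $$-iy'''-(py')'+q'y=f ,$$ that is, $y\in W_1^2[0,1]$, the equation holds on $(0,1)$ in the sense of distributions (where $\langle q'y,\varphi\rangle=-\int_0^1 q\,(y\varphi)'\,dx$), and $y$, $y'$ and the continuous representative of $iy''+py'-qy$ each take equal values at $0$ and $1$. (2) For all $y,f\in L_2[0,1]$, the pair $(y,f)$ belongs to $T^\bullet$ if and only if there are absolutely continuous functions $y^{[0]}=y$, $y^{[1]}$, $y^{[2]}$ on $[0,1]$ satisfying almost everywhere $$(y^{[0]})'=y^{[1]},\qquad (y^{[1]})'=-iqy^{[0]}+ipy^{[1]}-iy^{[2]},\qquad (y^{[2]})'=-qy^{[1]}-f$$ and $y^{[0]}(1)-y^{[0]}(0)=y^{[1]}(1)-y^{[1]}(0)=y^{[2]}(1)-y^{[2]}(0)=0$. (3) If $p$ and $q$ are real-valued, then $T^\bullet$ is (the graph of) a densely defined,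 unbounded, self-adjoint operator in $L_2[0,1]$. -/

import Mathlib

set_option maxSynthPendingDepth 3

open MeasureTheory unitInterval ComplexConjugate
open scoped ContDiff ENNReal

noncomputable section

namespace ThirdOrder

/-- The complex space `L_1[0,1]`. -/
abbrev L1 : Type := Lp ℂ 1 (volume : Measure I)

/-- The complex Hilbert space `L_2[0,1]`. -/
abbrev L2 : Type := Lp ℂ 2 (volume : Measure I)

/-- The complex space `C[0,1]` with the supremum norm. -/
abbrev C0 : Type := C(I, ℂ)

/-- `u` is absolutely continuous on `[0,1]` with derivative `g ∈ L_1[0,1]` almost everywhere: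
`u(x) = u(0) + ∫_0^x g(t) dt` for all `x ∈ [0,1]`, with `g` summable. -/
def HasL1Deriv (u : C0) (g : I → ℂ) : Prop :=
  Integrable g ∧ ∀ x : I, u x = u 0 + ∫ t in Set.Iic x, g t

theorem HasL1Deriv.zero : HasL1Deriv 0 (fun _ => 0) :=
  ⟨integrable_zero _ _ _, fun x => by simp⟩

theorem HasL1Deriv.add {u v : C0} {g h : I → ℂ} (hu : HasL1Deriv u g) (hv : HasL1Deriv v h) :
    HasL1Deriv (u + v) (fun t => g t + h t) := by
  refine ⟨hu.1.add hv.1, fun x => ?_⟩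
  rw [integral_add hu.1.integrableOn hv.1.integrableOn, ContinuousMap.add_apply,
    ContinuousMap.add_apply, hu.2 x, hv.2 x]
  ring

theorem HasL1Deriv.smul {u : C0} {g : I → ℂ} (c : ℂ) (hu : HasL1Deriv u g) :
    HasL1Deriv (c • u) (fun t => c * g t) := by
  refine ⟨hu.1.const_mul c, fun x => ?_⟩
  rw [integral_const_mul, ContinuousMap.smul_apply, ContinuousMap.smul_apply, hu.2 x]
  simp only [smul_eq_mul]
  ring

theorem HasL1Deriv.congr {u : C0} {g h : I → ℂ} (hu : HasL1Deriv u g) (hgh : g =ᵐ[volume] h) :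
    HasL1Deriv u h :=
  ⟨hu.1.congr hgh, fun x => by rw [hu.2 x, integral_congr_ae (ae_restrict_of_ae hgh)]⟩

/-- The Sobolev space `W_1^2[0,1]`, an element `y` being represented by the triple
`(Y_0, Y_1, Y_2) = (y, y', y'')` in `C[0,1] × C[0,1] × L_1[0,1]`.  The norm (the maximum of the
norms of the three components) is equivalent to `‖y‖_C + ‖y'‖_C + ‖y''‖_{L_1}`. -/
def W21 : Submodule ℂ (C0 × C0 × L1) where
  carrier := {Y | HasL1Deriv Y.1 Y.2.1 ∧ HasL1Deriv Y.2.1 Y.2.2}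
  zero_mem' := ⟨HasL1Deriv.zero, HasL1Deriv.zero.congr (Lp.coeFn_zero ℂ 1 volume).symm⟩
  add_mem' := fun {Y Z} hY hZ =>
    ⟨hY.1.add hZ.1, (hY.2.add hZ.2).congr (Lp.coeFn_add Y.2.2 Z.2.2).symm⟩
  smul_mem' := fun c {Y} hY =>
    ⟨hY.1.smul c, (hY.2.smul c).congr (Lp.coeFn_smul c Y.2.2).symm⟩

/-- The space `W^2_{1,A,U}` of those `y ∈ W_1^2[0,1]` for which
`y(1) - y(0) = y'(1) - y'(0) = 0`. -/
def W21Per : Submodule ℂ (C0 × C0 × L1) where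
  carrier := {Y | Y ∈ W21 ∧ Y.1 1 - Y.1 0 = 0 ∧ Y.2.1 1 - Y.2.1 0 = 0}
  zero_mem' := ⟨W21.zero_mem, by simp, by simp⟩
  add_mem' := fun {Y Z} hY hZ => ⟨W21.add_mem hY.1 hZ.1,
    by have h1 := hY.2.1; have h2 := hZ.2.1; simp only [Prod.fst_add, ContinuousMap.add_apply]
       linear_combination h1 + h2,
    by have h1 := hY.2.2; have h2 := hZ.2.2
       simp only [Prod.fst_add, Prod.snd_add, ContinuousMap.add_apply]
       linear_combination h1 + h2⟩
  smul_mem' := fun c {Y} hY => ⟨W21.smul_mem c hY.1,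
    by have h1 := hY.2.1; simp only [Prod.smul_fst, ContinuousMap.smul_apply, smul_eq_mul]
       linear_combination c * h1,
    by have h1 := hY.2.2
       simp only [Prod.smul_fst, Prod.smul_snd, ContinuousMap.smul_apply, smul_eq_mul]
       linear_combination c * h1⟩

/-- The space `C^1_{B,V}` of those `z ∈ C^1[0,1]` for which `z(1) - z(0) = 0`, an element `z` being
represented by the pair `(Z_0, Z_1) = (z, z')`. -/
def C1Per : Submodule ℂ (C0 × C0) where
  carrier := {Z | HasL1Deriv Z.1 Z.2 ∧ Z.1 1 - Z.1 0 = 0}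
  zero_mem' := ⟨HasL1Deriv.zero, by simp⟩
  add_mem' := fun {Y Z} hY hZ => ⟨hY.1.add hZ.1,
    by have h1 := hY.2; have h2 := hZ.2; simp only [Prod.fst_add, ContinuousMap.add_apply]
       linear_combination h1 + h2⟩
  smul_mem' := fun c {Y} hY => ⟨hY.1.smul c,
    by have h1 := hY.2; simp only [Prod.smul_fst, ContinuousMap.smul_apply, smul_eq_mul]
       linear_combination c * h1⟩

theorem integrable_mul_cont {f : I → ℂ} (hf : Integrable f) (g : C0) :
    Integrable (fun x => f x * g x) :=
  hf.mul_bdd (c := ‖g‖) g.continuous.aestronglyMeasurable (Filter.Eventually.of_forall g.norm_coe_le_norm)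

theorem integrable_mul_conj {f : I → ℂ} (hf : Integrable f) (g : C0) :
    Integrable (fun x => f x * conj (g x)) :=
  hf.mul_bdd (c := ‖g‖) (Complex.continuous_conj.comp g.continuous).aestronglyMeasurable
    (Filter.Eventually.of_forall fun x => by
      simpa using g.norm_coe_le_norm x)

theorem integrable_L1 (f : L1) : Integrable (f : I → ℂ) := L1.integrable_coeFn f

theorem norm_integral_mul_conj_le (f : L1) (g : C0) :
    ‖∫ x, f x * conj (g x)‖ ≤ ‖f‖ * ‖g‖ := by
  refine (norm_integral_le_integral_norm _).trans ?_
  rw [L1.norm_eq_integral_norm, ← integral_mul_const]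
  refine integral_mono (integrable_mul_conj (integrable_L1 f) g).norm
    ((integrable_L1 f).norm.mul_const _) fun x => ?_
  simp only [norm_mul, RCLike.norm_conj]
  exact mul_le_mul_of_nonneg_left (g.norm_coe_le_norm x) (norm_nonneg _)

/-- The bounded semilinear functionals `Z ↦ ∫ f_0 conj(Z_0) dx + ∫ f_1 conj(Z_1) dx` on
`C^1_{B,V}`, as a bounded linear map of `(f_0, f_1) ∈ L_1[0,1] × L_1[0,1]`. -/
def functional : (L1 × L1) →L[ℂ] (C1Per →L⋆[ℂ] ℂ) :=
  LinearMap.mkContinuous₂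
    (LinearMap.mk₂'ₛₗ (RingHom.id ℂ) (starRingEnd ℂ)
      (fun (f : L1 × L1) (Z : C1Per) =>
        (∫ x, f.1 x * conj (Z.1.1 x)) + ∫ x, f.2 x * conj (Z.1.2 x))
      (fun f g Z => by
        have h1 : (∫ x, (f + g).1 x * conj (Z.1.1 x)) =
            (∫ x, f.1 x * conj (Z.1.1 x)) + ∫ x, g.1 x * conj (Z.1.1 x) := by
          rw [← integral_add (integrable_mul_conj (integrable_L1 _) _)
            (integrable_mul_conj (integrable_L1 _) _)]
          refine integral_congr_ae ?_
          filter_upwards [Lp.coeFn_add f.1 g.1] with x hx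
          rw [Prod.fst_add, hx, Pi.add_apply, add_mul]
        have h2 : (∫ x, (f + g).2 x * conj (Z.1.2 x)) =
            (∫ x, f.2 x * conj (Z.1.2 x)) + ∫ x, g.2 x * conj (Z.1.2 x) := by
          rw [← integral_add (integrable_mul_conj (integrable_L1 _) _)
            (integrable_mul_conj (integrable_L1 _) _)]
          refine integral_congr_ae ?_
          filter_upwards [Lp.coeFn_add f.2 g.2] with x hx
          rw [Prod.snd_add, hx, Pi.add_apply, add_mul]
        rw [h1, h2]; ring)
      (fun c f Z => by
        have h1 : (∫ x, (c • f).1 x * conj (Z.1.1 x)) = c * ∫ x, f.1 x * conj (Z.1.1 x) := by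
          rw [← integral_const_mul]
          refine integral_congr_ae ?_
          filter_upwards [Lp.coeFn_smul c f.1] with x hx
          rw [Prod.smul_fst, hx, Pi.smul_apply, smul_eq_mul, mul_assoc]
        have h2 : (∫ x, (c • f).2 x * conj (Z.1.2 x)) = c * ∫ x, f.2 x * conj (Z.1.2 x) := by
          rw [← integral_const_mul]
          refine integral_congr_ae ?_
          filter_upwards [Lp.coeFn_smul c f.2] with x hx
          rw [Prod.smul_snd, hx, Pi.smul_apply, smul_eq_mul, mul_assoc]
        rw [h1, h2, RingHom.id_apply, smul_eq_mul]; ring)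
      (fun f Y Z => by
        have h1 : (∫ x, f.1 x * conj ((Y + Z).1.1 x)) =
            (∫ x, f.1 x * conj (Y.1.1 x)) + ∫ x, f.1 x * conj (Z.1.1 x) := by
          rw [← integral_add (integrable_mul_conj (integrable_L1 _) _)
            (integrable_mul_conj (integrable_L1 _) _)]
          refine integral_congr_ae (Filter.Eventually.of_forall fun x => ?_)
          simp [mul_add]
        have h2 : (∫ x, f.2 x * conj ((Y + Z).1.2 x)) =
            (∫ x, f.2 x * conj (Y.1.2 x)) + ∫ x, f.2 x * conj (Z.1.2 x) := by
          rw [← integral_add (integrable_mul_conj (integrable_L1 _) _)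
            (integrable_mul_conj (integrable_L1 _) _)]
          refine integral_congr_ae (Filter.Eventually.of_forall fun x => ?_)
          simp [mul_add]
        rw [h1, h2]; ring)
      (fun c f Z => by
        have h1 : (∫ x, f.1 x * conj ((c • Z).1.1 x)) =
            conj c * ∫ x, f.1 x * conj (Z.1.1 x) := by
          rw [← integral_const_mul]
          refine integral_congr_ae (Filter.Eventually.of_forall fun x => ?_)
          simp [mul_left_comm]
        have h2 : (∫ x, f.2 x * conj ((c • Z).1.2 x)) =
            conj c * ∫ x, f.2 x * conj (Z.1.2 x) := by
          rw [← integral_const_mul]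
          refine integral_congr_ae (Filter.Eventually.of_forall fun x => ?_)
          simp [mul_left_comm]
        rw [h1, h2, smul_eq_mul]; ring))
    2
    (fun f Z => by
      refine (norm_add_le _ _).trans ?_
      have h1 := norm_integral_mul_conj_le f.1 Z.1.1
      have h2 := norm_integral_mul_conj_le f.2 Z.1.2
      have h3 : ‖f.1‖ * ‖Z.1.1‖ ≤ ‖f‖ * ‖Z‖ :=
        mul_le_mul (norm_fst_le f) (norm_fst_le Z.1) (norm_nonneg _) (norm_nonneg _)
      have h4 : ‖f.2‖ * ‖Z.1.2‖ ≤ ‖f‖ * ‖Z‖ :=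
        mul_le_mul (norm_snd_le f) (norm_snd_le Z.1) (norm_nonneg _) (norm_nonneg _)
      linarith)

theorem functional_apply (f : L1 × L1) (Z : C1Per) :
    functional f Z = (∫ x, f.1 x * conj (Z.1.1 x)) + ∫ x, f.2 x * conj (Z.1.2 x) := rfl

/-- The space `W^{-1}_{1,B,V}` of the semilinear functionals
`Z ↦ ∫ f_0 conj(Z_0) dx + ∫ f_1 conj(Z_1) dx` on `C^1_{B,V}`, where `f_0, f_1 ∈ L_1[0,1]`,
with the norm of the space of bounded semilinear functionals on `C^1_{B,V}`. -/
abbrev WNeg : Submodule ℂ (C1Per →L⋆[ℂ] ℂ) := LinearMap.range (functional : (L1 × L1) →ₗ[ℂ] (C1Per →L⋆[ℂ] ℂ))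

/-- Multiplication by `p ∈ L_1[0,1]`, as a bounded operator from `C[0,1]` to `L_1[0,1]`. -/
def mulL1 (p : L1) : C0 →L[ℂ] L1 :=
  LinearMap.mkContinuous
    { toFun := fun g => (integrable_mul_cont (integrable_L1 p) g).toL1 (fun x => p x * g x)
      map_add' := fun g h => by
        rw [← Integrable.toL1_add]
        congr 1
        funext x
        simp [mul_add]
      map_smul' := fun c g => by
        rw [RingHom.id_apply, ← Integrable.toL1_smul']
        congr 1
        funext x
        simp [mul_left_comm] }
    ‖p‖
    (fun g => by
      rw [LinearMap.coe_mk, AddHom.coe_mk, L1.norm_eq_integral_norm, L1.norm_eq_integral_norm,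
        ← integral_mul_const]
      refine integral_mono_ae (L1.integrable_coeFn _).norm
        ((integrable_L1 p).norm.mul_const _) ?_
      filter_upwards [(integrable_mul_cont (integrable_L1 p) g).coeFn_toL1] with x hx
      rw [hx, norm_mul]
      exact mul_le_mul_of_nonneg_left (g.norm_coe_le_norm x) (norm_nonneg _))

theorem coeFn_mulL1 (p : L1) (g : C0) : mulL1 p g =ᵐ[volume] fun x => p x * g x :=
  (integrable_mul_cont (integrable_L1 p) g).coeFn_toL1

theorem memLp_one_L2 (z : L2) : MemLp z 1 (volume : Measure I) :=
  (Lp.memLp z).mono_exponent (by norm_num)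

/-- The natural embedding of `L_2[0,1]` into `L_1[0,1]`. -/
def L2toL1 : L2 →L[ℂ] L1 :=
  LinearMap.mkContinuous
    { toFun := fun z => (memLp_one_L2 z).toLp z
      map_add' := fun z w => by
        rw [← MemLp.toLp_add]
        exact MemLp.toLp_congr _ _ (Lp.coeFn_add z w)
      map_smul' := fun c z => by
        rw [RingHom.id_apply, ← MemLp.toLp_const_smul]
        exact MemLp.toLp_congr _ _ (Lp.coeFn_smul c z) }
    1
    (fun z => by
      rw [one_mul, LinearMap.coe_mk, AddHom.coe_mk, Lp.norm_toLp, Lp.norm_def]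
      exact ENNReal.toReal_mono (Lp.eLpNorm_ne_top z)
        (eLpNorm_le_eLpNorm_of_exponent_le (by norm_num) (Lp.aestronglyMeasurable z)))

theorem coeFn_L2toL1 (z : L2) : L2toL1 z =ᵐ[volume] z := (memLp_one_L2 z).coeFn_toLp

/-- The natural embedding of `C[0,1]` into `L_2[0,1]`. -/
abbrev C0toL2 : C0 →L[ℂ] L2 := ContinuousMap.toLp 2 volume ℂ

/-- The embedding `I : W^2_{1,A,U} → L_2[0,1]`, `Y ↦ Y_0`. -/
def embI : W21Per →L[ℂ] L2 :=
  C0toL2.comp ((ContinuousLinearMap.fst ℂ C0 (C0 × L1)).comp W21Per.subtypeL)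

/-- The embedding `J : L_2[0,1] → W^{-1}_{1,B,V}`, `⟨Jz, Z⟩ = ∫ z conj(Z_0) dx`. -/
def embJ : L2 →L[ℂ] WNeg :=
  (functional.comp ((ContinuousLinearMap.inl ℂ L1 L1).comp L2toL1)).codRestrict WNeg
    (fun z => ⟨(L2toL1 z, 0), rfl⟩)

theorem embJ_apply (z : L2) (Z : C1Per) : (embJ z).1 Z = ∫ x, z x * conj (Z.1.1 x) := by
  change functional (L2toL1 z, 0) Z = _
  rw [functional_apply]
  have h1 : (∫ x, L2toL1 z x * conj (Z.1.1 x)) = ∫ x, z x * conj (Z.1.1 x) := by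
    refine integral_congr_ae ?_
    filter_upwards [coeFn_L2toL1 z] with x hx
    rw [hx]
  have h2 : (∫ x, (0 : L1) x * conj (Z.1.2 x)) = 0 := by
    rw [← integral_zero I ℂ]
    refine integral_congr_ae ?_
    filter_upwards [Lp.coeFn_zero ℂ 1 (volume : Measure I)] with x hx
    rw [hx]
    simp
  simp only [h1, h2, add_zero]

/-- The bounded map `Y ↦ (Y_0, Y_1, Y_2) ↦ i Y_2 + p Y_1 - q Y_0 ∈ L_1[0,1]`. -/
def flux (p q : L1) : (C0 × C0 × L1) →L[ℂ] L1 :=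
  let P0 : (C0 × C0 × L1) →L[ℂ] C0 := ContinuousLinearMap.fst ℂ C0 (C0 × L1)
  let P1 : (C0 × C0 × L1) →L[ℂ] C0 :=
    (ContinuousLinearMap.fst ℂ C0 L1).comp (ContinuousLinearMap.snd ℂ C0 (C0 × L1))
  let P2 : (C0 × C0 × L1) →L[ℂ] L1 :=
    (ContinuousLinearMap.snd ℂ C0 L1).comp (ContinuousLinearMap.snd ℂ C0 (C0 × L1))
  Complex.I • P2 + (mulL1 p).comp P1 - (mulL1 q).comp P0

/-- The bounded operator `T : W^2_{1,A,U} → W^{-1}_{1,B,V}`,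
`⟨TY, Z⟩ = ∫ [(i Y_2 + p Y_1 - q Y_0) conj(Z_1) - q Y_1 conj(Z_0)] dx`; see `opT_apply`. -/
def opT (p q : L1) : W21Per →L[ℂ] WNeg :=
  (functional.comp
    (ContinuousLinearMap.prod
      (-((mulL1 q).comp ((ContinuousLinearMap.fst ℂ C0 L1).comp
        ((ContinuousLinearMap.snd ℂ C0 (C0 × L1)).comp W21Per.subtypeL))))
      ((flux p q).comp W21Per.subtypeL))).codRestrict WNeg
    (fun Y => ⟨(-(mulL1 q Y.1.2.1), flux p q Y.1), rfl⟩)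

theorem coeFn_flux (p q : L1) (Y : C0 × C0 × L1) :
    flux p q Y =ᵐ[volume] fun x => Complex.I * Y.2.2 x + p x * Y.2.1 x - q x * Y.1 x := by
  change (Complex.I • Y.2.2 + mulL1 p Y.2.1 - mulL1 q Y.1 : L1) =ᵐ[volume] _
  filter_upwards [Lp.coeFn_sub (Complex.I • Y.2.2 + mulL1 p Y.2.1) (mulL1 q Y.1),
    Lp.coeFn_add (Complex.I • Y.2.2) (mulL1 p Y.2.1), Lp.coeFn_smul Complex.I Y.2.2,
    coeFn_mulL1 p Y.2.1, coeFn_mulL1 q Y.1] with x h1 h2 h3 h4 h5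
  rw [h1, Pi.sub_apply, h2, Pi.add_apply, h3, h4, h5, Pi.smul_apply, smul_eq_mul]

theorem opT_apply (p q : L1) (Y : W21Per) (Z : C1Per) :
    (opT p q Y).1 Z =
      ∫ x, ((Complex.I * Y.1.2.2 x + p x * Y.1.2.1 x - q x * Y.1.1 x) * conj (Z.1.2 x)
        - q x * Y.1.2.1 x * conj (Z.1.1 x)) := by
  change functional (-(mulL1 q Y.1.2.1), flux p q Y.1) Z = _
  rw [functional_apply, ← integral_add (integrable_mul_conj (integrable_L1 _) _)
    (integrable_mul_conj (integrable_L1 _) _)]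
  refine integral_congr_ae ?_
  filter_upwards [coeFn_flux p q Y.1, Lp.coeFn_neg (mulL1 q Y.1.2.1),
    coeFn_mulL1 q Y.1.2.1] with x h1 h2 h3
  simp only [h1, h2, Pi.neg_apply, h3]
  ring

/-- The linear relation `T^• = J⁻¹ T I⁻¹` in `H`, given by its graph
`{(y, z) : ∃ Y, I Y = y ∧ T Y = J z}`. -/
def relation {W V H : Type*} [AddCommMonoid W] [Module ℂ W] [AddCommMonoid V] [Module ℂ V]
    [AddCommMonoid H] [Module ℂ H] (i : W →ₗ[ℂ] H) (j : H →ₗ[ℂ] V) (T : W →ₗ[ℂ] V) :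
    Submodule ℂ (H × H) where
  carrier := {x | ∃ Y : W, i Y = x.1 ∧ T Y = j x.2}
  zero_mem' := ⟨0, by simp, by simp⟩
  add_mem' := by
    rintro x x' ⟨Y, h1, h2⟩ ⟨Y', h1', h2'⟩
    exact ⟨Y + Y', by simp [h1, h1'], by simp [h2, h2']⟩
  smul_mem' := by
    rintro c x ⟨Y, h1, h2⟩
    exact ⟨c • Y, by simp [h1], by simp [h2]⟩

/-- The linear relation `T^•` in `L_2[0,1]` of the third-order problem of periodic type. -/
def Tbullet (p q : L1) : Submodule ℂ (L2 × L2) :=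
  relation (embI : W21Per →ₗ[ℂ] L2) (embJ : L2 →ₗ[ℂ] WNeg) (opT p q : W21Per →ₗ[ℂ] WNeg)

/-- The differential equation `-i y''' - (p y')' + q' y = f` on the interval `(0,1)` in the sense
of distributions, for `y ∈ W_1^2[0,1]` given as the triple `Y = (y, y', y'')`.  The distribution
`q' y` acts by `φ ↦ ⟨q', y φ⟩ = -∫ q (y φ)' dx = -∫ q (y' φ + y φ') dx`. -/
def DistribEq (p q : L1) (Y : C0 × C0 × L1) (f : L2) : Prop :=
  ∀ φ : ℝ → ℂ, ContDiff ℝ ∞ φ → HasCompactSupport φ → tsupport φ ⊆ Set.Ioo 0 1 →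
    (∫ x : I, Complex.I * Y.1 x * iteratedDeriv 3 φ x) + (∫ x : I, p x * Y.2.1 x * deriv φ x)
      - (∫ x : I, q x * (Y.2.1 x * φ x + Y.1 x * deriv φ x)) = ∫ x : I, f x * φ x

/-- `y ∈ L_2[0,1]` solves the problem of periodic type for `-i y''' - (p y')' + q' y = f`:
`y` belongs to `W_1^2[0,1]`, satisfies the equation on `(0,1)` in the sense of distributions, and
`y`, `y'` and (the continuous representative of) the quasi-derivative `i y'' + p y' - q y` take
equal values at `0` and `1`. -/
def PeriodicProblem (p q : L1) (y f : L2) : Prop :=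
  ∃ Y ∈ W21, C0toL2 Y.1 = y ∧ DistribEq p q Y f ∧
    Y.1 1 - Y.1 0 = 0 ∧ Y.2.1 1 - Y.2.1 0 = 0 ∧
    ∃ u : C0, (∀ᵐ x : I, u x = Complex.I * Y.2.2 x + p x * Y.2.1 x - q x * Y.1 x) ∧ u 1 - u 0 = 0

/-- `y ∈ L_2[0,1]` is the component `y^{[0]}` of an absolutely continuous solution of
`(y^{[0]})' = y^{[1]}`, `(y^{[1]})' = -i q y^{[0]} + i p y^{[1]} - i y^{[2]}`,
`(y^{[2]})' = -q y^{[1]} - f` with periodic boundary conditions. -/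
def PeriodicSystem (p q : L1) (y f : L2) : Prop :=
  ∃ y₀ y₁ y₂ : C0, C0toL2 y₀ = y ∧
    HasL1Deriv y₀ y₁ ∧
    HasL1Deriv y₁ (fun x => -Complex.I * q x * y₀ x + Complex.I * p x * y₁ x
      - Complex.I * y₂ x) ∧
    HasL1Deriv y₂ (fun x => -q x * y₁ x - f x) ∧
    y₀ 1 - y₀ 0 = 0 ∧ y₁ 1 - y₁ 0 = 0 ∧ y₂ 1 - y₂ 0 = 0

end ThirdOrder

end

/-!
Write `T^•` for the relation `Tbullet p q`, and let `u = i y'' + p y' - q y` be the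
quasi-derivative of `y`.

The three descriptions of `T^•` agree because each of them says that `u`, a priori only summable,
is absolutely continuous with `u' = -q y' - f` and `u(1) = u(0)`. Testing `T Y = J f`, or the
distributional equation after two integrations by parts, against `C_c^∞(0,1)` gives `u' = -q y' - f`
in the sense of distributions, and the lemma of du Bois-Reymond
(`exists_ae_eq_const_of_integral_deriv_test`) provides the absolutely continuous representative
(`exists_hasL1Deriv_of_weak`). Testing `T Y = J f` with the constant `1` gives `u(1) = u(0)`.
Conversely, one integrates by parts; on `[0,1]` this is Fubini's theorem for primitives of summable
functions (`HasL1Deriv.integral_deriv_mul_add`).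

Let `p` and `q` be real. Then `T^•` is symmetric, since the two pairings differ by
`i ∫ (z' conj(y'))' = 0`. For a nonreal number `l` the equation `T^• y = l y + g`, written as an
integral equation for `(y, y', u)` in `C[0,1]³` with the initial values replaced by the values at
`1`, has the form `Y - K Y = G` with a compact operator `K` (`systemOp`; the Volterra operators in it
are compact by Arzelà–Ascoli). A solution of `K Y = Y` is an eigenvector of the symmetric relation
at a nonreal point and hence zero, so the Fredholm alternative makes the equation solvable for every
`g` (`exists_mem_Tbullet_of_im_ne_zero`). Symmetry and solvability at `l = ±i` give density of the
domain and self-adjointness (`isSelfAdjoint_of_symmetric`). A bounded self-adjoint operator is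
everywhere defined, while the domain of `T^•` contains only classes of continuous functions; hence
`T^•` is unbounded.
-/

noncomputable section

namespace ThirdOrder

/-! ### Primitives of summable functions on the unit interval -/

/-- The primitive `x ↦ ∫_0^x g` of a summable function is continuous. -/
theorem continuous_setIntegral_Iic {E : Type*} [NormedAddCommGroup E] [NormedSpace ℝ E]
    {g : I → E} (hg : Integrable g) : Continuous fun x : I => ∫ t in Set.Iic x, g t := by
  refine continuous_iff_continuousAt.2 fun x => ?_
  simp_rw [← integral_indicator measurableSet_Iic]
  refine tendsto_integral_filter_of_dominated_convergence (fun t => ‖g t‖)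
    (Filter.Eventually.of_forall fun y => hg.aestronglyMeasurable.indicator measurableSet_Iic)
    (Filter.Eventually.of_forall fun y => Filter.Eventually.of_forall fun t =>
      norm_indicator_le_norm_self _ _) hg.norm ?_
  -- For `t ≠ x` the value of the indicator of `Iic y` at `t` is constant for `y` near `x`.
  filter_upwards [Measure.ae_ne volume x] with t ht
  refine tendsto_const_nhds.congr' ?_
  rcases lt_or_gt_of_ne ht with h | h
  · filter_upwards [lt_mem_nhds h] with y hy
    simp [Set.indicator, h.le, hy.le]
  · filter_upwards [gt_mem_nhds h] with y hy
    simp [Set.indicator, h.not_ge, hy.not_ge]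

theorem setIntegral_Iic_sub {E : Type*} [NormedAddCommGroup E] [NormedSpace ℝ E]
    {g : I → E} (hg : Integrable g) {x y : I} (hxy : x ≤ y) :
    (∫ t in Set.Iic y, g t) - ∫ t in Set.Iic x, g t = ∫ t in Set.Ioc x y, g t := by
  rw [← Set.Iic_union_Ioc_eq_Iic hxy, setIntegral_union (s := Set.Iic x) (t := Set.Ioc x y)
    (Set.disjoint_left.2 fun t h1 h2 => (lt_of_lt_of_le h2.1 h1).false) measurableSet_Ioc
    hg.integrableOn hg.integrableOn, add_sub_cancel_left]

/-- The primitive `x ↦ ∫_0^x g` as an element of `C[0,1]`. -/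
def primitive (g : I → ℂ) (hg : Integrable g) : C0 :=
  ⟨fun x => ∫ t in Set.Iic x, g t, continuous_setIntegral_Iic hg⟩

theorem primitive_zero {g : I → ℂ} (hg : Integrable g) : primitive g hg 0 = 0 := by
  have : Set.Iic (0 : I) = {0} := Set.Iic_bot
  simp [primitive, this]

theorem hasL1Deriv_primitive {g : I → ℂ} (hg : Integrable g) : HasL1Deriv (primitive g hg) g :=
  ⟨hg, fun x => by rw [primitive_zero, zero_add]; rfl⟩

theorem Iic_one_eq_univ : Set.Iic (1 : I) = Set.univ :=
  Set.eq_univ_of_forall fun t => t.2.2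

theorem HasL1Deriv.apply_one {u : C0} {g : I → ℂ} (hu : HasL1Deriv u g) :
    u 1 = u 0 + ∫ t, g t := by
  rw [hu.2 1, Iic_one_eq_univ, Measure.restrict_univ]

theorem HasL1Deriv.conj {u : C0} {g : I → ℂ} (hu : HasL1Deriv u g) :
    HasL1Deriv (star u) (fun t => conj (g t)) := by
  refine ⟨(integrable_congr (Filter.EventuallyEq.rfl)).1
    (Complex.conjLIE.toContinuousLinearEquiv.toContinuousLinearMap.integrable_comp hu.1),
    fun x => ?_⟩
  rw [integral_conj, ContinuousMap.star_apply, ContinuousMap.star_apply, hu.2 x]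
  simp

theorem HasL1Deriv.const (c : ℂ) : HasL1Deriv (ContinuousMap.const I c) (fun _ => 0) :=
  ⟨integrable_zero _ _ _, fun x => by simp⟩

/-- The Fubini identity behind integration by parts: the two halves of the square `[0,1]²`
contribute `∫ g H` and `∫ G h`, where `G` and `H` are the primitives of `g` and `h`. -/
theorem integral_mul_primitive_add {g h : I → ℂ} (hg : Integrable g) (hh : Integrable h) :
    (∫ s, g s * ∫ t in Set.Iic s, h t) + (∫ t, (∫ s in Set.Iic t, g s) * h t)
      = (∫ s, g s) * ∫ t, h t := by
  have hF : Integrable (fun z : I × I => g z.1 * h z.2) (volume.prod volume) := hg.mul_prod hh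
  have hm : MeasurableSet {z : I × I | z.2 ≤ z.1} := measurableSet_le measurable_snd measurable_fst
  have h1 : (∫ s, g s * ∫ t in Set.Iic s, h t)
      = ∫ z in {z : I × I | z.2 ≤ z.1}, g z.1 * h z.2 ∂(volume.prod volume) := by
    rw [← integral_indicator hm, integral_prod _ (hF.indicator hm)]
    refine integral_congr_ae (Filter.Eventually.of_forall fun s => ?_)
    simp only
    rw [← integral_const_mul, ← integral_indicator measurableSet_Iic]
    rfl
  have h2 : (∫ t, (∫ s in Set.Iic t, g s) * h t)
      = ∫ z in {z : I × I | z.2 ≤ z.1}ᶜ, g z.1 * h z.2 ∂(volume.prod volume) := by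
    rw [← integral_indicator hm.compl, integral_prod_symm _ (hF.indicator hm.compl)]
    refine integral_congr_ae (Filter.Eventually.of_forall fun t => ?_)
    simp only
    rw [integral_Iic_eq_integral_Iio, ← integral_mul_const, ← integral_indicator measurableSet_Iio]
    congr 1
    funext s
    simp [Set.indicator]
  rw [h1, h2, integral_add_compl hm hF, integral_prod_mul]

/-- Integration by parts for absolutely continuous functions on `[0,1]`. -/
theorem HasL1Deriv.integral_deriv_mul_add {u v : C0} {g h : I → ℂ} (hu : HasL1Deriv u g)
    (hv : HasL1Deriv v h) :
    (∫ x, g x * v x) + (∫ x, u x * h x) = u 1 * v 1 - u 0 * v 0 := by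
  have h1 : (∫ x, g x * v x) = (∫ x, g x) * v 0 + ∫ x, g x * ∫ t in Set.Iic x, h t := by
    rw [← integral_mul_const, ← integral_add (hu.1.mul_const _)]
    · refine integral_congr_ae (Filter.Eventually.of_forall fun x => ?_)
      simp only
      rw [hv.2 x]; ring
    · exact integrable_mul_cont hu.1 (primitive h hv.1)
  have h2 : (∫ x, u x * h x) = u 0 * (∫ x, h x) + ∫ x, (∫ t in Set.Iic x, g t) * h x := by
    rw [← integral_const_mul, ← integral_add (hv.1.const_mul _)]
    · refine integral_congr_ae (Filter.Eventually.of_forall fun x => ?_)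
      simp only
      rw [hu.2 x]; ring
    · simp_rw [mul_comm _ (h _)]
      exact integrable_mul_cont hv.1 (primitive g hu.1)
  rw [h1, h2, hu.apply_one, hv.apply_one]
  linear_combination integral_mul_primitive_add hu.1 hv.1

/-! ### Test functions -/

theorem setIntegral_Iic_comp_coe (f : ℝ → ℂ) (x : I) :
    ∫ t in Set.Iic x, f t = ∫ t in (0 : ℝ)..x, f t := by
  have h := measurePreserving_coe.setIntegral_preimage_emb measurableEmbedding_coe f
    (Set.Iic (x : ℝ))
  have h2 : Set.Iic (x : ℝ) ∩ I = Set.Icc 0 (x : ℝ) := by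
    ext t; simp only [Set.mem_inter_iff, Set.mem_Iic, Set.mem_Icc]
    exact ⟨fun h => ⟨h.2.1, h.1⟩, fun h => ⟨h.2, h.1, h.2.trans x.2.2⟩⟩
  rw [Measure.restrict_restrict measurableSet_Iic, h2, integral_Icc_eq_integral_Ioc,
    ← intervalIntegral.integral_of_le x.2.1] at h
  exact h

theorem integral_comp_coe (f : ℝ → ℂ) : ∫ t : I, f t = ∫ t in Set.Icc (0 : ℝ) 1, f t :=
  measurePreserving_coe.integral_comp measurableEmbedding_coe f

/-- The restriction to `[0,1]` of a continuous function on the line. -/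
def restr (φ : ℝ → ℂ) (h : Continuous φ) : C0 := ⟨fun x => φ x, h.comp continuous_subtype_val⟩

theorem hasL1Deriv_restr {φ : ℝ → ℂ} (h : ContDiff ℝ 1 φ) :
    HasL1Deriv (restr φ h.continuous) (fun x => deriv φ x) := by
  have hc : Continuous (deriv φ) := h.continuous_deriv le_rfl
  refine ⟨(restr _ hc).continuous.integrable_of_hasCompactSupport
    (HasCompactSupport.of_compactSpace _), fun x => ?_⟩
  rw [setIntegral_Iic_comp_coe, intervalIntegral.integral_deriv_eq_sub
    (fun t _ => (h.differentiable one_ne_zero).differentiableAt) (hc.intervalIntegrable _ _)]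
  simp [restr]

/-- `φ` is a test function on the open interval `(0,1)`. -/
structure IsTest (φ : ℝ → ℂ) : Prop where
  contDiff : ContDiff ℝ ∞ φ
  hasCompactSupport : HasCompactSupport φ
  tsupport_subset : tsupport φ ⊆ Set.Ioo 0 1

theorem IsTest.deriv {φ : ℝ → ℂ} (h : IsTest φ) : IsTest (deriv φ) :=
  ⟨h.contDiff.deriv', h.hasCompactSupport.deriv, tsupport_deriv_subset.trans h.tsupport_subset⟩

theorem IsTest.contDiff_one {φ : ℝ → ℂ} (h : IsTest φ) : ContDiff ℝ 1 φ :=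
  h.contDiff.of_le (by norm_cast)

theorem IsTest.apply_zero {φ : ℝ → ℂ} (h : IsTest φ) : φ 0 = 0 :=
  image_eq_zero_of_notMem_tsupport fun h0 => (h.tsupport_subset h0).1.false

theorem IsTest.apply_one {φ : ℝ → ℂ} (h : IsTest φ) : φ 1 = 0 :=
  image_eq_zero_of_notMem_tsupport fun h0 => (h.tsupport_subset h0).2.false

theorem IsTest.const_smul {φ : ℝ → ℂ} (h : IsTest φ) (c : ℂ) : IsTest (fun x => c * φ x) :=
  ⟨contDiff_const.mul h.contDiff, h.hasCompactSupport.mul_left,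
    (closure_mono fun _ hx => right_ne_zero_of_mul hx).trans h.tsupport_subset⟩

theorem IsTest.sub {φ ψ : ℝ → ℂ} (h : IsTest φ) (h' : IsTest ψ) : IsTest (fun x => φ x - ψ x) :=
  ⟨h.contDiff.sub h'.contDiff, h.hasCompactSupport.sub h'.hasCompactSupport,
    (tsupport_sub φ ψ).trans (Set.union_subset h.tsupport_subset h'.tsupport_subset)⟩

theorem IsTest.conj {φ : ℝ → ℂ} (h : IsTest φ) : IsTest (fun x => conj (φ x)) :=
  ⟨Complex.conjCLE.contDiff.comp h.contDiff,
    h.hasCompactSupport.comp_left (map_zero _),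
    (closure_mono fun x hx => by simpa using hx).trans h.tsupport_subset⟩

/-- Integration by parts against a test function produces no boundary terms. -/
theorem HasL1Deriv.integral_mul_deriv_test {u : C0} {g : I → ℂ} (hu : HasL1Deriv u g)
    {φ : ℝ → ℂ} (h : IsTest φ) : ∫ x : I, u x * deriv φ x = -∫ x : I, g x * φ x := by
  have := hu.integral_deriv_mul_add (hasL1Deriv_restr h.contDiff_one)
  simp only [restr, ContinuousMap.coe_mk, Set.Icc.coe_one, Set.Icc.coe_zero, h.apply_one,
    h.apply_zero, mul_zero, sub_zero] at this
  linear_combination this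

theorem IsTest.exists_tsupport_subset_Icc {φ : ℝ → ℂ} (h : IsTest φ) :
    ∃ a b : ℝ, 0 < a ∧ b < 1 ∧ tsupport φ ⊆ Set.Icc a b := by
  have hK : IsCompact (tsupport φ) := h.hasCompactSupport
  rcases (tsupport φ).eq_empty_or_nonempty with he | hne
  · exact ⟨1, 0, one_pos, one_pos, he ▸ Set.empty_subset _⟩
  · exact ⟨_, _, (h.tsupport_subset (hK.sInf_mem hne)).1, (h.tsupport_subset (hK.sSup_mem hne)).2,
      fun x hx => ⟨csInf_le hK.bddBelow hx, le_csSup hK.bddAbove hx⟩⟩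

/-- A test function of mean zero is the derivative of a test function. -/
theorem IsTest.exists_deriv_eq {φ : ℝ → ℂ} (h : IsTest φ) (h0 : ∫ x : I, φ x = 0) :
    ∃ ψ, IsTest ψ ∧ _root_.deriv ψ = φ := by
  obtain ⟨a, b, ha, hb, hab⟩ := h.exists_tsupport_subset_Icc
  have hc : Continuous φ := h.contDiff.continuous
  have hd : _root_.deriv (fun x : ℝ => ∫ t in (0 : ℝ)..x, φ t) = φ :=
    funext fun x => hc.deriv_integral φ 0 x
  have hz : ∀ t, t ∉ Set.Icc a b → φ t = 0 := fun t ht =>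
    image_eq_zero_of_notMem_tsupport fun h' => ht (hab h')
  have h1 : ∫ t in (0 : ℝ)..1, φ t = 0 := by
    rw [intervalIntegral.integral_of_le zero_le_one, ← integral_Icc_eq_integral_Ioc,
      ← integral_comp_coe, h0]
  have hsupp : Function.support (fun x : ℝ => ∫ t in (0 : ℝ)..x, φ t) ⊆ Set.Icc a b := by
    intro x hx
    by_contra hx'
    refine hx ?_
    rw [Set.mem_Icc, not_and_or, not_le, not_le] at hx'
    rcases hx' with hx' | hx'
    · refine intervalIntegral.integral_zero_ae (Filter.Eventually.of_forall fun t ht => hz t ?_)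
      intro h'
      rcases Set.mem_uIoc.1 ht with h2 | h2
      · linarith [h2.2, h'.1]
      · linarith [h2.2, h'.1]
    · change ∫ t in (0 : ℝ)..x, φ t = 0
      rw [← intervalIntegral.integral_add_adjacent_intervals (hc.intervalIntegrable 0 1)
        (hc.intervalIntegrable 1 x), h1, zero_add]
      refine intervalIntegral.integral_zero_ae (Filter.Eventually.of_forall fun t ht => hz t ?_)
      intro h'
      rcases Set.mem_uIoc.1 ht with h2 | h2
      · linarith [h2.1, h'.2]
      · linarith [h2.1, h'.2]
  refine ⟨_, ⟨?_, HasCompactSupport.of_support_subset_isCompact isCompact_Icc hsupp, ?_⟩, hd⟩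
  · rw [contDiff_infty_iff_deriv, hd]
    exact ⟨fun x => (hc.integral_hasStrictDerivAt 0 x).hasDerivAt.differentiableAt, h.contDiff⟩
  · exact (closure_minimal hsupp isClosed_Icc).trans fun x hx =>
      ⟨ha.trans_le hx.1, hx.2.trans_lt hb⟩

/-- The fundamental lemma of the calculus of variations on `(0,1)`. -/
theorem ae_eq_zero_of_integral_test {g : I → ℂ} (hg : Integrable g)
    (h : ∀ φ, IsTest φ → ∫ x : I, g x * φ x = 0) : g =ᵐ[volume] 0 := by
  -- Extend `g` to the line by its values at the endpoints; only its values on `(0,1)` matter.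
  set G : ℝ → ℂ := fun x => g (Set.projIcc 0 1 zero_le_one x) with hG
  have hGg : ∀ x : I, G x = g x := fun x => by rw [hG]; simp only [Set.projIcc_val]
  have hGi : IntegrableOn G (Set.Icc 0 1) := by
    refine (measurePreserving_coe.integrable_comp_emb measurableEmbedding_coe).1 ?_
    exact hg.congr (Filter.Eventually.of_forall fun x => (hGg x).symm)
  have key := isOpen_Ioo.ae_eq_zero_of_integral_contDiff_smul_eq_zero
    (hGi.mono_set Set.Ioo_subset_Icc_self).locallyIntegrableOn (fun ψ h1 h2 h3 => by
      have hs : tsupport (fun x => (ψ x : ℂ)) ⊆ tsupport ψ :=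
        closure_mono fun x hx => by simpa using hx
      have hψ : IsTest fun x => (ψ x : ℂ) :=
        ⟨Complex.ofRealCLM.contDiff.comp h1, h2.comp_left Complex.ofReal_zero, hs.trans h3⟩
      rw [← h _ hψ, ← setIntegral_eq_integral_of_forall_compl_eq_zero (s := Set.Icc 0 1),
        ← integral_comp_coe]
      · refine integral_congr_ae (Filter.Eventually.of_forall fun x => ?_)
        simp only [hGg, Complex.real_smul]
        ring
      · intro x hx
        rw [image_eq_zero_of_notMem_tsupport fun h' => hx (Set.Ioo_subset_Icc_self (h3 h')),
          zero_smul])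
  have key2 : ∀ᵐ x : I, (x : ℝ) ∈ Set.Ioo (0 : ℝ) 1 → G x = 0 :=
    measurePreserving_coe.quasiMeasurePreserving.ae (ae_restrict_of_ae key)
  filter_upwards [key2, Measure.ae_ne volume (0 : I), Measure.ae_ne volume (1 : I)]
    with x hx h0 h1
  rw [← hGg x, hx ⟨unitInterval.pos_iff_ne_zero.2 h0, unitInterval.lt_one_iff_ne_one.2 h1⟩]
  rfl

theorem exists_isTest_integral_eq_one : ∃ φ, IsTest φ ∧ ∫ x : I, φ x = 1 := by
  -- Otherwise the function `1` would be orthogonal to all test functions.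
  have : ∃ φ, IsTest φ ∧ ∫ x : I, φ x ≠ 0 := by
    by_contra! hne
    have h := ae_eq_zero_of_integral_test (g := fun _ => 1) (integrable_const _)
      (by simpa using hne)
    obtain ⟨x, hx⟩ := h.exists
    exact one_ne_zero hx
  obtain ⟨φ, h1, h2⟩ := this
  exact ⟨_, h1.const_smul (∫ x : I, φ x)⁻¹, by rw [integral_const_mul, inv_mul_cancel₀ h2]⟩

theorem IsTest.integrable_mul {φ : ℝ → ℂ} (h : IsTest φ) {g : I → ℂ} (hg : Integrable g) :
    Integrable (fun x : I => g x * φ x) :=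
  integrable_mul_cont hg (restr φ h.contDiff.continuous)

/-- The lemma of du Bois-Reymond: a summable function on `(0,1)` with zero distributional
derivative is constant. -/
theorem exists_ae_eq_const_of_integral_deriv_test {g : I → ℂ} (hg : Integrable g)
    (h : ∀ φ, IsTest φ → ∫ x : I, g x * deriv φ x = 0) : ∃ c : ℂ, g =ᵐ[volume] fun _ => c := by
  obtain ⟨φ₀, h0, h1⟩ := exists_isTest_integral_eq_one
  refine ⟨∫ x : I, g x * φ₀ x, ?_⟩
  set c := ∫ x : I, g x * φ₀ x
  have key := ae_eq_zero_of_integral_test (hg.sub (integrable_const c)) fun φ hφ => by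
    have h1φ : Integrable fun x : I => φ x := by
      simpa using hφ.integrable_mul (integrable_const (1 : ℂ))
    have h1φ₀ : Integrable fun x : I => φ₀ x := by
      simpa using h0.integrable_mul (integrable_const (1 : ℂ))
    -- Subtracting a multiple of `φ₀` from `φ` produces mean zero.
    obtain ⟨ψ, hψ, hd⟩ := (hφ.sub (h0.const_smul (∫ x : I, φ x))).exists_deriv_eq (by
      rw [integral_sub h1φ (h1φ₀.const_mul _), integral_const_mul, h1, mul_one, sub_self])
    have h2 := h ψ hψ
    rw [hd] at h2
    have h3 : (∫ x : I, g x * (φ x - (∫ x : I, φ x) * φ₀ x))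
        = (∫ x : I, g x * φ x) - (∫ x : I, φ x) * c := by
      rw [← integral_const_mul, ← integral_sub (hφ.integrable_mul hg)
        ((h0.integrable_mul hg).const_mul _)]
      refine integral_congr_ae (Filter.Eventually.of_forall fun x => ?_)
      simp only
      ring
    simp only [Pi.sub_apply, sub_mul]
    rw [integral_sub (hφ.integrable_mul hg) (h1φ.const_mul c), integral_const_mul]
    linear_combination h2 - h3
  filter_upwards [key] with x hx
  exact sub_eq_zero.1 hx

/-- By linearity, this is the almost everywhere uniqueness of the derivative of an absolutely
continuous function. -/
theorem HasL1Deriv.ae_eq_zero {g : I → ℂ} (h : HasL1Deriv 0 g) : g =ᵐ[volume] 0 :=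
  ae_eq_zero_of_integral_test h.1 fun φ hφ => by
    have := h.integral_mul_deriv_test hφ
    simp only [ContinuousMap.zero_apply, zero_mul, integral_zero] at this
    exact neg_eq_zero.1 this.symm

instance isOpenPosMeasure_volume : (volume : Measure I).IsOpenPosMeasure where
  open_pos := by
    rintro _ ⟨V, hV, rfl⟩ ⟨x, hx⟩ h0
    have hcl : (x : ℝ) ∈ closure (Set.Ioo (0 : ℝ) 1) := by
      rw [closure_Ioo zero_ne_one]; exact x.2
    have h1 := (hV.inter isOpen_Ioo).measure_pos volume (mem_closure_iff.1 hcl V hV hx)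
    refine h1.ne' (measure_mono_null ?_ (unitInterval.volume_apply.symm.trans h0))
    exact fun t ht => ⟨⟨t, Set.Ioo_subset_Icc_self ht.2⟩, ht.1, rfl⟩

theorem eq_of_ae_eq {u v : C0} (h : ∀ᵐ x : I, u x = v x) : u = v :=
  DFunLike.coe_injective (u.continuous.ae_eq_iff_eq volume v.continuous |>.1 h)

/-! ### Regularity of weak solutions and the equivalence of the three problems -/

theorem integrable_L2 (f : L2) : Integrable (f : I → ℂ) := memLp_one_iff_integrable.1 (memLp_one_L2 f)

/-- The quasi-derivative `i Y_2 + p Y_1 - q Y_0` as a function. -/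
def fluxFun (p q : L1) (Y : C0 × C0 × L1) (x : I) : ℂ :=
  Complex.I * Y.2.2 x + p x * Y.2.1 x - q x * Y.1 x

theorem integrable_fluxFun (p q : L1) (Y : C0 × C0 × L1) : Integrable (fluxFun p q Y) :=
  (integrable_L1 (flux p q Y)).congr (coeFn_flux p q Y)

/-- The right-hand side of the last equation of the system is summable. -/
theorem integrable_source (q : L1) (f : L2) (v : C0) : Integrable fun x : I => -q x * v x - f x :=
  ((integrable_mul_cont (integrable_L1 q) v).neg.sub (integrable_L2 f)).congr
    (Filter.Eventually.of_forall fun x => by simp)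

theorem mem_Tbullet_iff (p q : L1) (y f : L2) : (y, f) ∈ Tbullet p q ↔
    ∃ Y ∈ W21Per, C0toL2 Y.1 = y ∧ ∀ Z ∈ C1Per,
      ∫ x, (fluxFun p q Y x * conj (Z.2 x) - q x * Y.2.1 x * conj (Z.1 x))
        = ∫ x, f x * conj (Z.1 x) := by
  constructor
  · rintro ⟨Y, h1, h2⟩
    refine ⟨Y.1, Y.2, h1, fun Z hZ => ?_⟩
    have h3 : (opT p q Y).1 ⟨Z, hZ⟩ = (embJ f).1 ⟨Z, hZ⟩ := by
      have h2' : opT p q Y = embJ f := h2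
      rw [h2']
    rwa [opT_apply, embJ_apply] at h3
  · rintro ⟨Y, hY, h1, h2⟩
    refine ⟨⟨Y, hY⟩, h1, Subtype.ext (ContinuousLinearMap.ext fun Z => ?_)⟩
    change (opT p q ⟨Y, hY⟩).1 Z = (embJ f).1 Z
    rw [opT_apply, embJ_apply]
    exact h2 Z.1 Z.2

/-- A weak solution tested against `C_c^∞(0,1)` has an absolutely continuous quasi-derivative. -/
theorem exists_hasL1Deriv_of_weak {F s : I → ℂ} (hF : Integrable F) (hs : Integrable s)
    (h : ∀ φ, IsTest φ → ∫ x : I, F x * deriv φ x = -∫ x : I, s x * φ x) :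
    ∃ u : C0, HasL1Deriv u s ∧ ∀ᵐ x : I, u x = F x := by
  set v : C0 := primitive s hs
  have hvs : HasL1Deriv v s := hasL1Deriv_primitive hs
  have hvi : Integrable v := v.continuous.integrable_of_hasCompactSupport
    (HasCompactSupport.of_compactSpace _)
  obtain ⟨c, hc⟩ := exists_ae_eq_const_of_integral_deriv_test (hF.sub hvi) fun φ hφ => by
    simp only [Pi.sub_apply, sub_mul]
    rw [integral_sub (hφ.deriv.integrable_mul hF) (hφ.deriv.integrable_mul hvi), h φ hφ,
      hvs.integral_mul_deriv_test hφ, sub_self]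
  refine ⟨v + ContinuousMap.const I c, (hvs.add (HasL1Deriv.const c)).congr
    (Filter.Eventually.of_forall fun x => by simp), ?_⟩
  filter_upwards [hc] with x hx
  simp only [Pi.sub_apply] at hx
  simp [← hx]

/-- Two integrations by parts turn the distributional form of the equation into the form in which
the quasi-derivative is paired with `φ'`. -/
theorem distribEq_iff {p q : L1} {Y : C0 × C0 × L1} (hY : Y ∈ W21) (f : L2) :
    DistribEq p q Y f ↔ ∀ φ, IsTest φ → ∫ x : I, fluxFun p q Y x * deriv φ x
      = -∫ x : I, (-q x * Y.2.1 x - f x) * φ x := by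
  have key : ∀ φ, IsTest φ →
      ((∫ x : I, Complex.I * Y.1 x * iteratedDeriv 3 φ x) + (∫ x : I, p x * Y.2.1 x * deriv φ x)
        - (∫ x : I, q x * (Y.2.1 x * φ x + Y.1 x * deriv φ x)) = (∫ x : I, f x * φ x) ↔
      (∫ x : I, fluxFun p q Y x * deriv φ x) = -∫ x : I, (-q x * Y.2.1 x - f x) * φ x) := by
    intro φ hφ
    have i1 := hφ.deriv.integrable_mul (integrable_L1 Y.2.2)
    have i2 := hφ.deriv.integrable_mul (integrable_mul_cont (integrable_L1 p) Y.2.1)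
    have i3 := hφ.deriv.integrable_mul (integrable_mul_cont (integrable_L1 q) Y.1)
    have i4 := hφ.integrable_mul (integrable_mul_cont (integrable_L1 q) Y.2.1)
    have i5 := hφ.integrable_mul (integrable_L2 f)
    have e1 : (∫ x : I, Complex.I * Y.1 x * iteratedDeriv 3 φ x)
        = Complex.I * ∫ x : I, Y.2.2 x * deriv φ x := by
      have h3 : iteratedDeriv 3 φ = deriv (deriv (deriv φ)) := by
        simp [iteratedDeriv_succ, iteratedDeriv_zero]
      simp_rw [mul_assoc, h3]
      rw [integral_const_mul, hY.1.integral_mul_deriv_test hφ.deriv.deriv,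
        hY.2.integral_mul_deriv_test hφ.deriv, neg_neg]
    have e2 : (∫ x : I, q x * (Y.2.1 x * φ x + Y.1 x * deriv φ x))
        = (∫ x : I, q x * Y.2.1 x * φ x) + ∫ x : I, q x * Y.1 x * deriv φ x := by
      rw [← integral_add i4 i3]
      exact integral_congr_ae (Filter.Eventually.of_forall fun x => by ring)
    have e3 : (∫ x : I, fluxFun p q Y x * deriv φ x)
        = Complex.I * (∫ x : I, Y.2.2 x * deriv φ x) + (∫ x : I, p x * Y.2.1 x * deriv φ x)
          - ∫ x : I, q x * Y.1 x * deriv φ x := by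
      have i12 : Integrable fun x : I => Complex.I * (Y.2.2 x * deriv φ x)
          + p x * Y.2.1 x * deriv φ x := (i1.const_mul _).add i2
      rw [← integral_const_mul, ← integral_add (i1.const_mul _) i2, ← integral_sub i12 i3]
      exact integral_congr_ae (Filter.Eventually.of_forall fun x => by simp [fluxFun]; ring)
    have e4 : (∫ x : I, (-q x * Y.2.1 x - f x) * φ x)
        = -(∫ x : I, q x * Y.2.1 x * φ x) - ∫ x : I, f x * φ x := by
      have i4n : Integrable fun x : I => -(q x * Y.2.1 x * φ x) := i4.neg
      rw [← integral_neg, ← integral_sub i4n i5]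
      exact integral_congr_ae (Filter.Eventually.of_forall fun x => by ring)
    rw [e1, e2, e3, e4]
    constructor <;> intro h <;> linear_combination h
  exact ⟨fun h φ hφ => (key φ hφ).1 (h φ hφ.1 hφ.2 hφ.3),
    fun h φ h1 h2 h3 => (key φ ⟨h1, h2, h3⟩).2 (h φ ⟨h1, h2, h3⟩)⟩

/-- The first-order system in terms of the triple `Y = (y, y', y'')` and the continuous
representative `u` of the quasi-derivative. -/
theorem periodicSystem_iff (p q : L1) (y f : L2) : PeriodicSystem p q y f ↔
    ∃ Y ∈ W21Per, ∃ u : C0, C0toL2 Y.1 = y ∧ HasL1Deriv u (fun x => -q x * Y.2.1 x - f x) ∧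
      (∀ᵐ x : I, u x = fluxFun p q Y x) ∧ u 1 - u 0 = 0 := by
  constructor
  · rintro ⟨y₀, y₁, y₂, h1, h2, h3, h4, b0, b1, b2⟩
    refine ⟨(y₀, y₁, h3.1.toL1 _), ⟨⟨h2, h3.congr h3.1.coeFn_toL1.symm⟩, b0, b1⟩, y₂, h1, h4, ?_, b2⟩
    filter_upwards [h3.1.coeFn_toL1] with x hx
    simp only [fluxFun, hx]
    linear_combination (q x * y₀ x - p x * y₁ x + y₂ x) * Complex.I_sq
  · rintro ⟨Y, hY, u, h1, h2, h3, h4⟩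
    refine ⟨Y.1, Y.2.1, u, h1, hY.1.1, hY.1.2.congr ?_, h2, hY.2.1, hY.2.2, h4⟩
    filter_upwards [h3] with x hx
    rw [hx, fluxFun]
    linear_combination Y.2.2 x * Complex.I_sq

theorem periodicProblem_iff_periodicSystem (p q : L1) (y f : L2) :
    PeriodicProblem p q y f ↔ PeriodicSystem p q y f := by
  rw [periodicSystem_iff]
  constructor
  · rintro ⟨Y, hY, h1, h2, b0, b1, u, hu, b2⟩
    obtain ⟨v, hv, hvF⟩ := exists_hasL1Deriv_of_weak (integrable_fluxFun p q Y)
      (integrable_source q f Y.2.1) ((distribEq_iff hY f).1 h2)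
    have huv : u = v := eq_of_ae_eq (by filter_upwards [hu, hvF] with x h h' using h.trans h'.symm)
    exact ⟨Y, ⟨hY, b0, b1⟩, u, h1, huv ▸ hv, hu, b2⟩
  · rintro ⟨Y, hY, u, h1, h2, h3, h4⟩
    refine ⟨Y, hY.1, h1, (distribEq_iff hY.1 f).2 fun φ hφ => ?_, hY.2.1, hY.2.2, u, h3, h4⟩
    rw [← h2.integral_mul_deriv_test hφ]
    refine integral_congr_ae ?_
    filter_upwards [h3] with x hx
    rw [hx]

theorem const_mem_C1Per (c : ℂ) : ((ContinuousMap.const I c, 0) : C0 × C0) ∈ C1Per :=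
  ⟨HasL1Deriv.const c, by simp⟩

theorem mem_Tbullet_iff_periodicSystem (p q : L1) (y f : L2) :
    (y, f) ∈ Tbullet p q ↔ PeriodicSystem p q y f := by
  rw [mem_Tbullet_iff, periodicSystem_iff]
  -- The source term of the system, split off from the pairing with `conj Z`.
  have split : ∀ (Y : C0 × C0 × L1) (Z : C0 × C0),
      (∫ x, (fluxFun p q Y x * conj (Z.2 x) - q x * Y.2.1 x * conj (Z.1 x))
        = (∫ x, f x * conj (Z.1 x))) ↔
      (∫ x, fluxFun p q Y x * conj (Z.2 x))
        = -∫ x, (-q x * Y.2.1 x - f x) * conj (Z.1 x) := by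
    intro Y Z
    have i1 := integrable_mul_conj (integrable_fluxFun p q Y) Z.2
    have i2 := integrable_mul_conj (integrable_mul_cont (integrable_L1 q) Y.2.1) Z.1
    have i3 := integrable_mul_conj (integrable_L2 f) Z.1
    have e : (∫ x, (-q x * Y.2.1 x - f x) * conj (Z.1 x))
        = -(∫ x, q x * Y.2.1 x * conj (Z.1 x)) - ∫ x, f x * conj (Z.1 x) := by
      have i2n : Integrable fun x : I => -(q x * Y.2.1 x * conj (Z.1 x)) := i2.neg
      rw [← integral_neg, ← integral_sub i2n i3]
      exact integral_congr_ae (Filter.Eventually.of_forall fun x => by ring)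
    rw [integral_sub i1 i2, e]
    constructor <;> intro h <;> linear_combination h
  constructor
  · rintro ⟨Y, hY, h1, h2⟩
    obtain ⟨u, hu, huF⟩ := exists_hasL1Deriv_of_weak (integrable_fluxFun p q Y)
      (integrable_source q f Y.2.1) fun φ hφ => by
        have hc := hφ.conj
        have hZ : (restr _ hc.contDiff.continuous, restr _ hc.deriv.contDiff.continuous) ∈ C1Per :=
          ⟨hasL1Deriv_restr hc.contDiff_one, by simp [restr, hφ.apply_zero, hφ.apply_one]⟩
        have hd : ∀ x, conj (deriv (fun t => conj (φ t)) x) = deriv φ x := fun x => by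
          have h := deriv.star (f := φ) (x := x)
          rw [RCLike.star_def] at h
          exact (congrArg conj h).trans (Complex.conj_conj _)
        simpa [restr, hd] using (split Y _).1 (h2 _ hZ)
    refine ⟨Y, hY, u, h1, hu, huF, ?_⟩
    -- Testing with the constant `1` gives the boundary condition for the quasi-derivative.
    have h3 := (split Y _).1 (h2 _ (const_mem_C1Per 1))
    simp only [ContinuousMap.zero_apply, map_zero, mul_zero, integral_zero,
      ContinuousMap.const_apply, map_one, mul_one] at h3
    rw [hu.apply_one, neg_eq_zero.1 h3.symm]
    ring
  · rintro ⟨Y, hY, u, h1, h2, h3, h4⟩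
    refine ⟨Y, hY, h1, fun Z hZ => (split Y Z).2 ?_⟩
    have h5 := h2.integral_deriv_mul_add hZ.1.conj
    simp only [ContinuousMap.star_apply, RCLike.star_def] at h5
    have h6 : (∫ x, fluxFun p q Y x * conj (Z.2 x)) = ∫ x, u x * conj (Z.2 x) :=
      integral_congr_ae (by filter_upwards [h3] with x hx; rw [hx])
    rw [h6, sub_eq_zero.1 h4, sub_eq_zero.1 hZ.2] at *
    linear_combination h5

theorem HasL1Deriv.eq_zero {v : C0} (h : HasL1Deriv 0 v) : v = 0 :=
  eq_of_ae_eq h.ae_eq_zero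

/-- A solution of the first-order system whose first component vanishes is zero. -/
theorem system_eq_zero {p q : L1} {y₁ y₂ : C0} (h1 : HasL1Deriv 0 y₁)
    (h2 : HasL1Deriv y₁ (fun x => -Complex.I * q x * (0 : C0) x + Complex.I * p x * y₁ x
      - Complex.I * y₂ x)) : y₁ = 0 ∧ y₂ = 0 := by
  obtain rfl := h1.eq_zero
  refine ⟨rfl, eq_of_ae_eq ?_⟩
  filter_upwards [h2.ae_eq_zero] with x hx
  simpa using hx

theorem C0toL2_injective : Function.Injective C0toL2 := ContinuousMap.toLp_injective _

/-- `T^•` is single-valued. -/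
theorem eq_zero_of_zero_mem_Tbullet (p q : L1) {f : L2} (h : (0, f) ∈ Tbullet p q) : f = 0 := by
  obtain ⟨y₀, y₁, y₂, h1, h2, h3, h4, -⟩ := (mem_Tbullet_iff_periodicSystem p q 0 f).1 h
  obtain rfl : y₀ = 0 := C0toL2_injective (by rw [h1, map_zero])
  obtain ⟨rfl, rfl⟩ := system_eq_zero h2 h3
  refine (Lp.eq_zero_iff_ae_eq_zero).2 ?_
  filter_upwards [h4.ae_eq_zero] with x hx
  simpa using hx

/-! ### Symmetry -/

theorem inner_eq_integral_of_toL2 (u : C0) (f : L2) :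
    inner ℂ (C0toL2 u) f = ∫ x, f x * conj (u x) := by
  rw [L2.inner_def]
  refine integral_congr_ae ?_
  filter_upwards [ContinuousMap.coeFn_toLp (p := 2) (𝕜 := ℂ) volume u] with x hx
  rw [hx]
  rfl

/-- The relation `T^•` is symmetric when `p` and `q` are real: the two pairings differ by
`i ∫ (Z_1 conj(Y_1))' dx`, which vanishes by periodicity. -/
theorem inner_eq_inner_of_mem_Tbullet {p q : L1} (hp : ∀ᵐ x, (p x).im = 0)
    (hq : ∀ᵐ x, (q x).im = 0) {y f z g : L2} (h : (y, f) ∈ Tbullet p q)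
    (h' : (z, g) ∈ Tbullet p q) : inner ℂ f z = inner ℂ y g := by
  obtain ⟨Y, hY, rfl, hYT⟩ := (mem_Tbullet_iff p q y f).1 h
  obtain ⟨Z, hZ, rfl, hZT⟩ := (mem_Tbullet_iff p q z g).1 h'
  have e1 := hYT (Z.1, Z.2.1) ⟨hZ.1.1, hZ.2.1⟩
  have e2 := hZT (Y.1, Y.2.1) ⟨hY.1.1, hY.2.1⟩
  rw [← inner_eq_integral_of_toL2] at e1 e2
  rw [← inner_conj_symm, ← e1, ← e2, ← integral_conj, eq_comm, ← sub_eq_zero, ← integral_sub]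
  · have b := hZ.1.2.integral_deriv_mul_add hY.1.2.conj
    have i1 := integrable_mul_conj (integrable_L1 Z.2.2) Y.2.1
    have i2 : Integrable fun x => Z.2.1 x * conj (Y.2.2 x) :=
      (integrable_mul_cont hY.1.2.conj.1 Z.2.1).congr
        (Filter.Eventually.of_forall fun x => mul_comm _ _)
    simp only [ContinuousMap.star_apply, RCLike.star_def] at b
    rw [← integral_add i1 i2, sub_eq_zero.1 hZ.2.2, sub_eq_zero.1 hY.2.2, sub_self] at b
    rw [← mul_zero Complex.I, ← b, ← integral_const_mul]
    refine integral_congr_ae ?_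
    filter_upwards [hp, hq] with x hpx hqx
    simp only [fluxFun, map_sub, map_add, map_mul, Complex.conj_I, Complex.conj_conj,
      Complex.conj_eq_iff_im.2 hpx, Complex.conj_eq_iff_im.2 hqx]
    ring
  · exact (integrable_mul_conj (integrable_fluxFun p q Z) Y.2.1).sub
      (integrable_mul_conj (integrable_mul_cont (integrable_L1 q) Z.2.1) Y.1)
  · exact Complex.conjLIE.toContinuousLinearEquiv.toContinuousLinearMap.integrable_comp
      ((integrable_mul_conj (integrable_fluxFun p q Y) Z.2.1).sub
        (integrable_mul_conj (integrable_mul_cont (integrable_L1 q) Y.2.1) Z.1))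

/-! ### Solvability of the resolvent equation -/

theorem norm_primitive_mul_le (a : L1) (u : C0) :
    ‖primitive (fun x => a x * u x) (integrable_mul_cont (integrable_L1 a) u)‖ ≤ ‖a‖ * ‖u‖ := by
  refine (ContinuousMap.norm_le _ (by positivity)).2 fun x => ?_
  refine (norm_integral_le_integral_norm _).trans ?_
  rw [L1.norm_eq_integral_norm, ← integral_mul_const]
  refine (setIntegral_le_integral (integrable_mul_cont (integrable_L1 a) u).norm
    (Filter.Eventually.of_forall fun t => norm_nonneg _)).trans ?_
  refine integral_mono (integrable_mul_cont (integrable_L1 a) u).norm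
    ((integrable_L1 a).norm.mul_const _) fun t => ?_
  simp only [norm_mul]
  exact mul_le_mul_of_nonneg_left (u.norm_coe_le_norm t) (norm_nonneg _)

/-- The Volterra operator `u ↦ ∫_0^x a u` on `C[0,1]`. -/
def volterra (a : L1) : C0 →L[ℂ] C0 :=
  LinearMap.mkContinuous
    { toFun := fun u => primitive (fun x => a x * u x) (integrable_mul_cont (integrable_L1 a) u)
      map_add' := fun u v => by
        ext x
        change ∫ t in Set.Iic x, a t * (u + v) t = _
        simp only [ContinuousMap.add_apply, mul_add]
        exact integral_add (integrable_mul_cont (integrable_L1 a) u).integrableOn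
          (integrable_mul_cont (integrable_L1 a) v).integrableOn
      map_smul' := fun c u => by
        ext x
        change ∫ t in Set.Iic x, a t * (c • u) t = _
        simp only [ContinuousMap.smul_apply, smul_eq_mul, mul_left_comm _ c]
        exact integral_const_mul c _ }
    ‖a‖
    (norm_primitive_mul_le a)

theorem volterra_norm_le (a : L1) (u : C0) : ‖volterra a u‖ ≤ ‖a‖ * ‖u‖ :=
  norm_primitive_mul_le a u

theorem volterra_zero (a : L1) (u : C0) : volterra a u 0 = 0 :=
  primitive_zero (integrable_mul_cont (integrable_L1 a) u)

theorem hasL1Deriv_volterra (a : L1) (u : C0) : HasL1Deriv (volterra a u) fun x => a x * u x :=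
  hasL1Deriv_primitive (integrable_mul_cont (integrable_L1 a) u)

/-- The modulus of continuity of `volterra a u` is controlled by that of the primitive of `‖a‖`. -/
theorem dist_volterra_le (a : L1) {u : C0} (hu : ‖u‖ ≤ 1) (x y : I) :
    dist (volterra a u x) (volterra a u y)
      ≤ dist (∫ t in Set.Iic x, ‖a t‖) (∫ t in Set.Iic y, ‖a t‖) := by
  wlog hxy : x ≤ y generalizing x y
  · rw [dist_comm, dist_comm (∫ t in Set.Iic x, ‖a t‖)]
    exact this y x (le_of_not_ge hxy)
  have i1 := integrable_mul_cont (integrable_L1 a) u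
  rw [dist_comm, dist_comm (∫ t in Set.Iic x, ‖a t‖), dist_eq_norm, Real.dist_eq,
    setIntegral_Iic_sub (integrable_L1 a).norm hxy]
  change ‖(∫ t in Set.Iic y, a t * u t) - ∫ t in Set.Iic x, a t * u t‖ ≤ _
  rw [setIntegral_Iic_sub i1 hxy]
  refine (norm_integral_le_integral_norm _).trans ((integral_mono i1.norm.integrableOn
    (integrable_L1 a).norm.integrableOn fun t => ?_).trans (le_abs_self _))
  simp only [norm_mul]
  exact mul_le_of_le_one_right (norm_nonneg _) ((u.norm_coe_le_norm t).trans hu)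

theorem isCompactOperator_volterra (a : L1) : IsCompactOperator (volterra a) := by
  let e := ContinuousMap.linearIsometryBoundedOfCompact I ℂ ℂ
  have hA : IsCompact (closure (e '' (volterra a '' Metric.ball 0 1))) := by
    refine BoundedContinuousFunction.arzela_ascoli (Metric.closedBall 0 ‖a‖)
      (isCompact_closedBall _ _) _ ?_ ?_
    · rintro _ x ⟨_, ⟨u, hu, rfl⟩, rfl⟩
      rw [mem_closedBall_zero_iff]
      refine ((volterra a u).norm_coe_le_norm x).trans ((volterra_norm_le a u).trans ?_)
      exact mul_le_of_le_one_right (norm_nonneg _) (mem_ball_zero_iff.1 hu).le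
    · intro x
      refine Metric.equicontinuousAt_of_continuity_modulus
        (fun y => dist (∫ t in Set.Iic x, ‖a t‖) (∫ t in Set.Iic y, ‖a t‖)) ?_ _
        (Filter.Eventually.of_forall ?_)
      · have hc : Continuous fun y : I =>
            dist (∫ t in Set.Iic x, ‖a t‖) (∫ t in Set.Iic y, ‖a t‖) :=
          continuous_const.dist (continuous_setIntegral_Iic (integrable_L1 a).norm)
        simpa using hc.tendsto x
      · rintro y ⟨_, _, ⟨u, hu, rfl⟩, rfl⟩
        exact dist_volterra_le a (mem_ball_zero_iff.1 hu).le x y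
  refine ⟨e.symm '' closure (e '' (volterra a '' Metric.ball 0 1)), hA.image e.symm.continuous,
    Filter.mem_of_superset (Metric.ball_mem_nhds 0 one_pos) fun u hu => ?_⟩
  exact ⟨e (volterra a u), subset_closure ⟨_, ⟨u, hu, rfl⟩, rfl⟩, e.symm_apply_apply _⟩

theorem isCompactOperator_prod {E F G : Type*} [Zero E] [TopologicalSpace E]
    [TopologicalSpace F] [TopologicalSpace G] {f : E → F} {g : E → G}
    (hf : IsCompactOperator f) (hg : IsCompactOperator g) :
    IsCompactOperator fun x => (f x, g x) := by
  obtain ⟨K, hK, hKf⟩ := hf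
  obtain ⟨K', hK', hKg⟩ := hg
  exact ⟨K ×ˢ K', hK.prod hK', Filter.mem_of_superset (Filter.inter_mem hKf hKg) fun x hx => hx⟩

/-- The map sending `u` to the constant function with value `u(1)`. -/
def constEvalOne : C0 →L[ℂ] C0 :=
  (ContinuousLinearMap.toSpanSingleton ℂ (1 : C0)).comp (ContinuousMap.evalCLM ℂ 1)

theorem constEvalOne_apply (u : C0) (x : I) : constEvalOne u x = u 1 := by
  simp [constEvalOne]

theorem isCompactOperator_constEvalOne : IsCompactOperator constEvalOne :=
  (isCompactOperator_of_locallyCompactSpace_dom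
    (ContinuousMap.evalCLM ℂ (1 : I) : C0 →L[ℂ] ℂ)).clm_comp
      (ContinuousLinearMap.toSpanSingleton ℂ (1 : C0))

/-- The constant function `1` in `L_1[0,1]`. -/
def oneL1 : L1 := (integrable_const (1 : ℂ)).toL1 _

theorem coeFn_oneL1 : oneL1 =ᵐ[volume] fun _ => 1 := (integrable_const (1 : ℂ)).coeFn_toL1

/-- The operator whose fixed points are the solutions of the periodic first-order system for
`T^• y = l y`: the integral form of the system, with the initial values `y^{[j]}(0)` replaced
by `y^{[j]}(1)`. -/
def systemOp (p q : L1) (l : ℂ) : (C0 × C0 × C0) →L[ℂ] (C0 × C0 × C0) :=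
  let P0 : (C0 × C0 × C0) →L[ℂ] C0 := ContinuousLinearMap.fst ℂ C0 (C0 × C0)
  let P1 : (C0 × C0 × C0) →L[ℂ] C0 :=
    (ContinuousLinearMap.fst ℂ C0 C0).comp (ContinuousLinearMap.snd ℂ C0 (C0 × C0))
  let P2 : (C0 × C0 × C0) →L[ℂ] C0 :=
    (ContinuousLinearMap.snd ℂ C0 C0).comp (ContinuousLinearMap.snd ℂ C0 (C0 × C0))
  (constEvalOne.comp P0 + (volterra oneL1).comp P1).prod
    ((constEvalOne.comp P1 + (-Complex.I) • (volterra q).comp P0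
      + Complex.I • (volterra p).comp P1 + (-Complex.I) • (volterra oneL1).comp P2).prod
    (constEvalOne.comp P2 - (volterra q).comp P1 - l • (volterra oneL1).comp P0))

theorem isCompactOperator_systemOp (p q : L1) (l : ℂ) : IsCompactOperator (systemOp p q l) := by
  have hc := isCompactOperator_constEvalOne
  have hv := isCompactOperator_volterra
  refine isCompactOperator_prod ((hc.comp_clm _).add ((hv _).comp_clm _))
    (isCompactOperator_prod ((((hc.comp_clm _).add (((hv _).comp_clm _).smul _)).add
      (((hv _).comp_clm _).smul _)).add (((hv _).comp_clm _).smul _))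
      (((hc.comp_clm _).sub ((hv _).comp_clm _)).sub (((hv _).comp_clm _).smul _)))

/-- A solution of `Y - systemOp Y = (0, 0, -∫_0^x g)` solves the periodic system for
`T^• y = l y + g`. -/
theorem periodicSystem_of_sub_systemOp (p q : L1) (l : ℂ) (g : L2) (Y : C0 × C0 × C0)
    (h : Y - systemOp p q l Y = (0, 0, -primitive g (integrable_L2 g))) :
    HasL1Deriv Y.1 Y.2.1 ∧
    HasL1Deriv Y.2.1 (fun x => -Complex.I * q x * Y.1 x + Complex.I * p x * Y.2.1 x
      - Complex.I * Y.2.2 x) ∧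
    HasL1Deriv Y.2.2 (fun x => -q x * Y.2.1 x - (l * Y.1 x + g x)) ∧
    Y.1 1 - Y.1 0 = 0 ∧ Y.2.1 1 - Y.2.1 0 = 0 ∧ Y.2.2 1 - Y.2.2 0 = 0 := by
  have hc : ∀ u : C0, constEvalOne u = ContinuousMap.const I (u 1) := fun u =>
    ContinuousMap.ext fun x => constEvalOne_apply u x
  have e0 : Y.1 = ContinuousMap.const I (Y.1 1) + volterra oneL1 Y.2.1 := by
    rw [← hc]; exact sub_eq_zero.1 (congrArg Prod.fst h)
  have e1 : Y.2.1 = ContinuousMap.const I (Y.2.1 1) + (-Complex.I) • volterra q Y.1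
      + Complex.I • volterra p Y.2.1 + (-Complex.I) • volterra oneL1 Y.2.2 := by
    rw [← hc]; exact sub_eq_zero.1 (congrArg (fun z => z.2.1) h)
  have e2 : Y.2.2 = ContinuousMap.const I (Y.2.2 1) + (-1 : ℂ) • volterra q Y.2.1
      + (-l) • volterra oneL1 Y.1 + (-1 : ℂ) • primitive g (integrable_L2 g) := by
    have h2 : Y.2.2 - (constEvalOne Y.2.2 - volterra q Y.2.1 - l • volterra oneL1 Y.1)
      = -primitive g (integrable_L2 g) := congrArg (fun z => z.2.2) h
    rw [← hc]
    linear_combination (norm := module) h2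
  have d0 := (HasL1Deriv.const (Y.1 1)).add (hasL1Deriv_volterra oneL1 Y.2.1)
  have d1 := (((HasL1Deriv.const (Y.2.1 1)).add ((hasL1Deriv_volterra q Y.1).smul (-Complex.I))).add
    ((hasL1Deriv_volterra p Y.2.1).smul Complex.I)).add
      ((hasL1Deriv_volterra oneL1 Y.2.2).smul (-Complex.I))
  have d2 := (((HasL1Deriv.const (Y.2.2 1)).add ((hasL1Deriv_volterra q Y.2.1).smul (-1))).add
    ((hasL1Deriv_volterra oneL1 Y.1).smul (-l))).add
      ((hasL1Deriv_primitive (integrable_L2 g)).smul (-1))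
  rw [← e0] at d0
  rw [← e1] at d1
  rw [← e2] at d2
  refine ⟨d0.congr ?_, d1.congr ?_, d2.congr ?_, ?_, ?_, ?_⟩
  · filter_upwards [coeFn_oneL1] with x hx
    rw [hx]; ring
  · filter_upwards [coeFn_oneL1] with x hx
    rw [hx]; ring
  · filter_upwards [coeFn_oneL1] with x hx
    rw [hx]; ring
  · have := DFunLike.congr_fun e0 0
    simp [volterra_zero] at this
    rw [this, sub_self]
  · have := DFunLike.congr_fun e1 0
    simp [volterra_zero] at this
    rw [this, sub_self]
  · have := DFunLike.congr_fun e2 0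
    simp [volterra_zero, primitive_zero] at this
    rw [this, sub_self]

/-- The pair `(y, l y + g)` belongs to `T^•` when `Y - systemOp Y = (0, 0, -∫_0^x g)`. -/
theorem mem_Tbullet_of_sub_systemOp (p q : L1) (l : ℂ) (g : L2) (Y : C0 × C0 × C0)
    (h : Y - systemOp p q l Y = (0, 0, -primitive g (integrable_L2 g))) :
    (C0toL2 Y.1, l • C0toL2 Y.1 + g) ∈ Tbullet p q := by
  obtain ⟨h0, h1, h2, b⟩ := periodicSystem_of_sub_systemOp p q l g Y h
  refine (mem_Tbullet_iff_periodicSystem p q _ _).2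
    ⟨Y.1, Y.2.1, Y.2.2, rfl, h0, h1, h2.congr ?_, b⟩
  filter_upwards [Lp.coeFn_add (l • C0toL2 Y.1) g, Lp.coeFn_smul l (C0toL2 Y.1),
    ContinuousMap.coeFn_toLp (p := 2) (𝕜 := ℂ) volume Y.1] with x e1 e2 e3
  rw [e1, Pi.add_apply, e2, Pi.smul_apply, e3, smul_eq_mul]

/-- For nonreal `l` the resolvent equation `T^• y - l y = g` is solvable for every `g`. -/
theorem exists_mem_Tbullet_of_im_ne_zero {p q : L1} (hp : ∀ᵐ x, (p x).im = 0)
    (hq : ∀ᵐ x, (q x).im = 0) {l : ℂ} (hl : l.im ≠ 0) (g : L2) :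
    ∃ y, (y, l • y + g) ∈ Tbullet p q := by
  rcases (isCompactOperator_systemOp p q l).hasEigenvalue_or_mem_resolventSet one_ne_zero with
    h | h
  · -- An eigenvector would give an eigenvector of the symmetric relation at the nonreal point `l`.
    exfalso
    obtain ⟨Y, hY⟩ := h.exists_hasEigenvector
    have hYe : systemOp p q l Y = Y := by simpa using hY.apply_eq_smul
    have hY0 : Y - systemOp p q l Y = (0, 0, -primitive (0 : L2) (integrable_L2 0)) := by
      have : primitive (0 : L2) (integrable_L2 0) = 0 := by
        ext x
        exact (integral_congr_ae (ae_restrict_of_ae (Lp.coeFn_zero ℂ 2 volume))).trans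
          (by simp)
      rw [hYe, sub_self, this, neg_zero]
      rfl
    have hmem := mem_Tbullet_of_sub_systemOp p q l 0 Y hY0
    rw [add_zero] at hmem
    have hsym := inner_eq_inner_of_mem_Tbullet hp hq hmem hmem
    rw [inner_smul_left, inner_smul_right, ← sub_eq_zero, ← sub_mul, mul_eq_zero,
      inner_self_eq_zero] at hsym
    have hy : Y.1 = 0 := C0toL2_injective <| by
      rw [map_zero]
      refine hsym.resolve_left fun h0 => hl ?_
      exact Complex.conj_eq_iff_im.1 (sub_eq_zero.1 h0)
    obtain ⟨h0, h1, -⟩ := periodicSystem_of_sub_systemOp p q l 0 Y hY0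
    rw [hy] at h0 h1
    obtain ⟨hy1, hy2⟩ := system_eq_zero h0 h1
    exact hY.2 (Prod.ext hy (Prod.ext hy1 hy2))
  · rw [spectrum.mem_resolventSet_iff, ContinuousLinearMap.isUnit_iff_bijective] at h
    obtain ⟨Y, hY⟩ := h.2 (0, 0, -primitive g (integrable_L2 g))
    exact ⟨_, mem_Tbullet_of_sub_systemOp p q l g Y (by simpa using hY)⟩

/-! ### Self-adjointness and unboundedness -/

variable {H : Type*} [NormedAddCommGroup H] [InnerProductSpace ℂ H]

theorem mem_graph_smul_add_iff (S : H →ₗ.[ℂ] H) (l : ℂ) (g : H) :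
    (∃ y, (y, l • y + g) ∈ S.graph) ↔ ∃ y : S.domain, S y = l • (y : H) + g := by
  simp only [LinearPMap.mem_graph_iff]
  exact ⟨fun ⟨_, y, h1, h2⟩ => ⟨y, by rw [h2, h1]⟩, fun ⟨y, h⟩ => ⟨y, y, rfl, h⟩⟩

/-- A symmetric operator is densely defined if `S - i` and `S + i` are surjective. -/
theorem dense_domain_of_symmetric [CompleteSpace H] {S : H →ₗ.[ℂ] H}
    (hsym : ∀ y z : S.domain, inner ℂ (S y) (z : H) = inner ℂ (y : H) (S z))
    (h1 : ∀ g, ∃ y : S.domain, S y = Complex.I • (y : H) + g)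
    (h2 : ∀ g, ∃ y : S.domain, S y = -Complex.I • (y : H) + g) :
    Dense (S.domain : Set H) := by
  rw [Submodule.dense_iff_topologicalClosure_eq_top,
    Submodule.topologicalClosure_eq_top_iff, Submodule.eq_bot_iff]
  intro g hg
  obtain ⟨y, hy⟩ := h1 g
  obtain ⟨z, hz⟩ := h2 y
  have e1 := hsym z y
  rw [hy, hz, inner_add_left, inner_add_right, inner_smul_left, inner_smul_right,
    (Submodule.mem_orthogonal _ _).1 hg z z.2, map_neg, Complex.conj_I, neg_neg, add_zero,
    add_eq_left, inner_self_eq_zero] at e1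
  have hy0 : y = 0 := Subtype.ext e1
  rw [hy0, LinearPMap.map_zero, ZeroMemClass.coe_zero, smul_zero, zero_add] at hy
  exact hy.symm

/-- The basic criterion for self-adjointness: a symmetric operator with `S - i` and `S + i`
surjective is self-adjoint. -/
theorem isSelfAdjoint_of_symmetric [CompleteSpace H] {S : H →ₗ.[ℂ] H}
    (hsym : ∀ y z : S.domain, inner ℂ (S y) (z : H) = inner ℂ (y : H) (S z))
    (h1 : ∀ g, ∃ y : S.domain, S y = Complex.I • (y : H) + g)
    (h2 : ∀ g, ∃ y : S.domain, S y = -Complex.I • (y : H) + g) : IsSelfAdjoint S := by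
  have hd := dense_domain_of_symmetric hsym h1 h2
  have hle : S ≤ S.adjoint := LinearPMap.IsFormalAdjoint.le_adjoint hd fun y z => hsym y z
  refine LinearPMap.isSelfAdjoint_def.2 (le_antisymm ?_ hle)
  refine LinearPMap.le_of_le_graph fun x hx => ?_
  obtain ⟨u, hu1, hu2⟩ := (LinearPMap.mem_graph_iff _).1 hx
  -- Choose `y` in the domain with `(S - i) y = (S† - i) u`; then `u - y` is orthogonal to the
  -- range of `S + i`, so `u = y`.
  obtain ⟨y, hy⟩ := h1 (S.adjoint u - Complex.I • (u : H))
  obtain ⟨z, hz⟩ := h2 ((u : H) - y)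
  have e1 := LinearPMap.adjoint_isFormalAdjoint hd u z
  have e2 := hsym y z
  have e3 : inner ℂ ((u : H) - y) ((u : H) - y) = 0 := by
    rw [hz, inner_add_right, inner_smul_right] at e1 e2
    have e4 : inner ℂ (S y) (z : H) = -Complex.I * inner ℂ (y : H) z
        + (inner ℂ (S.adjoint u) (z : H) + Complex.I * inner ℂ (u : H) z) := by
      rw [hy, inner_add_left, inner_sub_left, inner_smul_left, inner_smul_left, Complex.conj_I]
      ring
    rw [inner_sub_left]
    linear_combination e2 - e1 - e4
  have huy : (u : H) = y := sub_eq_zero.1 (inner_self_eq_zero.1 e3)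
  rw [huy, add_sub_cancel] at hy
  exact (LinearPMap.mem_graph_iff _).2 ⟨y, huy.symm.trans hu1, hy.trans hu2⟩

/-- A bounded self-adjoint operator is everywhere defined. -/
theorem domain_eq_top_of_bounded [CompleteSpace H] {S : H →ₗ.[ℂ] H} (hS : IsSelfAdjoint S)
    {c : ℝ} (hc : ∀ y : S.domain, ‖S y‖ ≤ c * ‖y‖) : S.domain = ⊤ := by
  rw [eq_top_iff]
  intro x _
  rw [← LinearPMap.isSelfAdjoint_def.1 hS, LinearPMap.mem_adjoint_domain_iff]
  have hcont : Continuous S.toFun := (S.toFun.mkContinuous c hc).continuous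
  exact (innerSL ℂ x).continuous.comp hcont

/-- The jump function `1_{[0,1/2)}` has no continuous representative. -/
theorem exists_L2_not_mem_range : ∃ f : L2, ∀ u : C0, C0toL2 u ≠ f := by
  have hm : MeasurableSet (Set.Iio (⟨1 / 2, by norm_num, by norm_num⟩ : I)) := measurableSet_Iio
  set a : I := ⟨1 / 2, by norm_num, by norm_num⟩ with ha
  have hf : MemLp ((Set.Iio a).indicator fun _ => (1 : ℂ)) 2 (volume : Measure I) :=
    (memLp_const 1).indicator hm
  refine ⟨hf.toLp _, fun u hu => ?_⟩
  have hae : ∀ᵐ x, u x = (Set.Iio a).indicator (fun _ => (1 : ℂ)) x := by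
    filter_upwards [ContinuousMap.coeFn_toLp (p := 2) (𝕜 := ℂ) volume u, hf.coeFn_toLp]
      with x h1 h2
    rw [← h1, ← h2]
    exact congrArg (fun g : L2 => g x) hu
  have h1 : Set.EqOn u (fun _ => 1) (Set.Iio a) :=
    Measure.eqOn_open_of_ae_eq ((ae_restrict_iff' hm).2 (by
      filter_upwards [hae] with x hx hxa
      rw [hx, Set.indicator_of_mem hxa])) isOpen_Iio u.continuous.continuousOn continuousOn_const
  have h0 : Set.EqOn u (fun _ => 0) (Set.Ioi a) :=
    Measure.eqOn_open_of_ae_eq ((ae_restrict_iff' measurableSet_Ioi).2 (by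
      filter_upwards [hae] with x hx hxa
      rw [hx]; exact Set.indicator_of_notMem (fun h => lt_asymm (Set.mem_Iio.1 h) (Set.mem_Ioi.1 hxa)) _)) isOpen_Ioi
      u.continuous.continuousOn continuousOn_const
  have hne1 : (Set.Iio a).Nonempty := ⟨0, by rw [ha, Set.mem_Iio, ← Subtype.coe_lt_coe]; norm_num⟩
  have hne0 : (Set.Ioi a).Nonempty := ⟨1, by rw [ha, Set.mem_Ioi, ← Subtype.coe_lt_coe]; norm_num⟩
  have e1 : u a = 1 := h1.closure u.continuous continuous_const
    (by rw [closure_Iio' hne1]; exact Set.self_mem_Iic)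
  have e0 : u a = 0 := h0.closure u.continuous continuous_const
    (by rw [closure_Ioi' hne0]; exact Set.self_mem_Ici)
  exact one_ne_zero (e1.symm.trans e0)

end ThirdOrder

end

theorem mainTheorem9 (p q : ThirdOrder.L1) :
    (∀ y f : ThirdOrder.L2, (y, f) ∈ ThirdOrder.Tbullet p q ↔ ThirdOrder.PeriodicProblem p q y f) ∧
    (∀ y f : ThirdOrder.L2, (y, f) ∈ ThirdOrder.Tbullet p q ↔ ThirdOrder.PeriodicSystem p q y f) ∧
    ((∀ᵐ x, (p x).im = 0) → (∀ᵐ x, (q x).im = 0) →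
      ∃ S : ThirdOrder.L2 →ₗ.[ℂ] ThirdOrder.L2,
        S.graph = ThirdOrder.Tbullet p q ∧
        Dense (S.domain : Set ThirdOrder.L2) ∧
        (¬ ∃ c : ℝ, ∀ y : S.domain, ‖S y‖ ≤ c * ‖y‖) ∧
        IsSelfAdjoint S) := by
  refine ⟨fun y f => (ThirdOrder.mem_Tbullet_iff_periodicSystem p q y f).trans
    (ThirdOrder.periodicProblem_iff_periodicSystem p q y f).symm,
    ThirdOrder.mem_Tbullet_iff_periodicSystem p q, fun hp hq => ?_⟩
  have hgraph : (ThirdOrder.Tbullet p q).toLinearPMap.graph = ThirdOrder.Tbullet p q :=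
    Submodule.toLinearPMap_graph_eq _ fun x hx hx0 => by
      obtain ⟨y, f⟩ := x
      obtain rfl : y = 0 := hx0
      exact ThirdOrder.eq_zero_of_zero_mem_Tbullet p q hx
  set S := (ThirdOrder.Tbullet p q).toLinearPMap
  have hmem : ∀ y : S.domain, ((y : ThirdOrder.L2), S y) ∈ ThirdOrder.Tbullet p q := fun y =>
    hgraph ▸ S.mem_graph y
  have hsym : ∀ y z : S.domain,
      inner ℂ (S y) (z : ThirdOrder.L2) = inner ℂ (y : ThirdOrder.L2) (S z) := fun y z =>
    ThirdOrder.inner_eq_inner_of_mem_Tbullet hp hq (hmem y) (hmem z)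
  have hsurj : ∀ l : ℂ, l.im ≠ 0 → ∀ g, ∃ y : S.domain, S y = l • (y : ThirdOrder.L2) + g :=
    fun l hl g => (ThirdOrder.mem_graph_smul_add_iff S l g).1
      (hgraph ▸ ThirdOrder.exists_mem_Tbullet_of_im_ne_zero hp hq hl g)
  have h1 := hsurj Complex.I (by simp)
  have h2 := hsurj (-Complex.I) (by simp)
  have hsa := ThirdOrder.isSelfAdjoint_of_symmetric hsym h1 h2
  refine ⟨S, hgraph, ThirdOrder.dense_domain_of_symmetric hsym h1 h2, ?_, hsa⟩
  rintro ⟨c, hc⟩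
  -- A bounded `S` would be defined on all of `L_2`, whereas its domain consists of classes of
  -- continuous functions.
  obtain ⟨f, hf⟩ := ThirdOrder.exists_L2_not_mem_range
  have hfS : f ∈ S.domain := ThirdOrder.domain_eq_top_of_bounded hsa hc ▸ Submodule.mem_top
  obtain ⟨Y, -, hY, -⟩ := (ThirdOrder.mem_Tbullet_iff p q _ _).1 (hmem ⟨f, hfS⟩)
  exact hf _ hY
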